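/- Let $G=(V,E)$ be a finite undirected graph and $T\subseteq V$ a set of terminals. A biset is a pair $\hat X=(X,X^+)$ with $X\subseteq X^+\subseteq V$; let $\mathcal V$ be the family of bisets with $X\neq\emptyset$, and let $\mathcal C$ be the family of those $\hat X\in\mathcal V$ for which $X\cap T=X^+\cap T=\{t\}$ for some $t\in T$. Let $\delta(\hat X)$ denote the set of edges with one end node in $X$ and the other in $V\setminus X^+$, and write $x(E')=\sum_{e\in E'}x(e)$ for $E' \subseteq E$. For $h\colon\mathcal V\to\mathbb R$ and $u\colon E\to\mathbb Z_{\ge 0}$ let $$P(h,u)=\{x\in\mathbb Q_{\ge 0}^E : x(\delta(\hat X))\ge h(\hat X)\ \text{for all } \hat X\in\mathcal V,\ x(e)\le u(e)\ \text{for all } e\in E\},$$ and for $y\colon E\to\mathbb Q_{\ge 0}$ let $h_{y}(\hat X)=h(\hat X)-y(\delta(\hat X))$. The function $h$ is called skew supermodular if, for all $\hat X,\hat Y\in\mathcal V$ with $h(\hat X)>0$ and $h(\hat Y)>0$, at least one of $$h(\hat X)+h(\hat Y)\le h(\hat X\cap\hat Y)+h(\hat X\cup\hat Y),\qquad h(\hat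 X)+h(\hat Y)\le h(\hat X\setminus\hat Y)+h(\hat Y\setminus\hat X)$$ holds, where $\hat X\cap\hat Y=(X\cap Y,X^+\cap Y^+)$, $\hat X\cup\hat Y=(X\cup Y,X^+\cup Y^+)$, $\hat X\setminus\hat Y=(X\setminus Y^+,X^+\setminus Y)$, and the value of $h$ at a biset with empty inner part is taken to be $0$. Suppose that $h$ is skew supermodular and that $h(\hat X)>0$ only if $\hat X\in\mathcal C$, and let $u\colon E\to\mathbb Z_{\ge 0}$. For every extreme point $x$ of $P(h,u)$, with $\lfloor x\rfloor$ denoting the componentwise floor of $x$, the vector $x-\lfloor x\rfloor$ is an extreme point of $P(h_{\lfloor x\rfloor},\mathbf 1)$, where $\mathbf 1$ is the all-one vector. Moreover, if $h$ is integer-valued, then every extreme point $x$ of $P(h,u)$ is half-integral, i.e. $2x(e)\in\mathbb Z$ for all $e\in E$. -/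

import Mathlib

/-- A biset on `V`: an ordered pair of node sets, the inner part being contained in the
outer part. -/
@[ext]
structure Biset (V : Type*) where
  inner : Finset V
  outer : Finset V
  inner_subset_outer : inner ⊆ outer

namespace Biset

variable {V : Type*} [DecidableEq V]

/-- `X ∩ Y = (X ∩ Y, X⁺ ∩ Y⁺)`. -/
def inter (X Y : Biset V) : Biset V where
  inner := X.inner ∩ Y.inner
  outer := X.outer ∩ Y.outer
  inner_subset_outer :=
    Finset.inter_subset_inter X.inner_subset_outer Y.inner_subset_outer

/-- `X ∪ Y = (X ∪ Y, X⁺ ∪ Y⁺)`. -/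
def union (X Y : Biset V) : Biset V where
  inner := X.inner ∪ Y.inner
  outer := X.outer ∪ Y.outer
  inner_subset_outer :=
    Finset.union_subset_union X.inner_subset_outer Y.inner_subset_outer

/-- `X \ Y = (X \ Y⁺, X⁺ \ Y)`. -/
def diff (X Y : Biset V) : Biset V where
  inner := X.inner \ Y.outer
  outer := X.outer \ Y.inner
  inner_subset_outer :=
    Finset.sdiff_subset_sdiff X.inner_subset_outer Y.inner_subset_outer

end Biset

/-- The family `𝒱` of all bisets on `V` with nonempty inner part. -/
abbrev NonemptyBiset (V : Type*) : Type _ := {X : Biset V // X.inner.Nonempty}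

/-- A (real-valued) biset function is defined on the bisets with nonempty inner part. -/
abbrev BisetFunction (V : Type*) : Type _ := NonemptyBiset V → ℝ

namespace BisetFunction

variable {V : Type*} [DecidableEq V]

/-- The value of a biset function on an arbitrary biset, with the usual convention that it is `0`
when the inner part is empty (such bisets may arise as `X ∩ Y`, `X \ Y` or `Y \ X`). -/
def value (h : BisetFunction V) (X : Biset V) : ℝ :=
  if hX : X.inner.Nonempty then h ⟨X, hX⟩ else 0

/-- (Positive) skew supermodularity. -/
def SkewSupermodular (h : BisetFunction V) : Prop :=
  ∀ X Y : NonemptyBiset V, 0 < h X → 0 < h Y →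
    h X + h Y ≤ h.value (X.1.inter Y.1) + h.value (X.1.union Y.1) ∨
    h X + h Y ≤ h.value (X.1.diff Y.1) + h.value (Y.1.diff X.1)

/-- Every value of `h` is an integer. -/
def IntegerValued (h : BisetFunction V) : Prop :=
  ∀ X : NonemptyBiset V, ∃ z : ℤ, h X = z

end BisetFunction

section Graph

variable {V E : Type*} [DecidableEq V] [Fintype E]

/-- The family `𝒞(t)` of the bisets `X` (with nonempty inner part) such that
`X ∩ T = X⁺ ∩ T = {t}`. -/
def terminalBisetsAt (T : Finset V) (t : V) : Set (NonemptyBiset V) :=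
  {X | X.1.inner ∩ T = {t} ∧ X.1.outer ∩ T = {t}}

/-- The family `𝒞`, the union of the families `𝒞(t)` over the terminals `t ∈ T`. -/
def terminalBisets (T : Finset V) : Set (NonemptyBiset V) :=
  ⋃ t ∈ T, terminalBisetsAt T t

open Classical in
/-- In the undirected (multi)graph with node set `V`, edge set `E` and end nodes `ends e` of the
edge `e`: the set `δ(X)` of edges with one end node in `X` and the other in `V \ X⁺`. -/
noncomputable def bisetCut (ends : E → Sym2 V) (X : Biset V) : Finset E :=
  Finset.univ.filter fun e => ∃ a b : V, ends e = s(a, b) ∧ a ∈ X.inner ∧ b ∉ X.outer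

/-- The polyhedron `P(h, u)`: all nonnegative rational vectors `x` with `x(δ(X)) ≥ h(X)` for all
bisets `X` with nonempty inner part, and `x(e) ≤ u(e)` for all edges `e`. -/
def coverPolyhedron (ends : E → Sym2 V) (h : BisetFunction V) (u : E → ℕ) : Set (E → ℚ) :=
  {x | (∀ e, 0 ≤ x e) ∧
    (∀ X : NonemptyBiset V, h X ≤ ((∑ e ∈ bisetCut ends X.1, x e : ℚ) : ℝ)) ∧
    ∀ e, x e ≤ u e}

/-- The residual biset function `h_x`, `h_x(X) = h(X) - x(δ(X))`. -/
noncomputable def residualFunction (ends : E → Sym2 V) (h : BisetFunction V) (x : E → ℚ) :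
    BisetFunction V :=
  fun X => h X - ((∑ e ∈ bisetCut ends X.1, x e : ℚ) : ℝ)

end Graph

/-! The fractional-part claim is a translation: adding `⌊x⌋` to two points of the residual
polyhedron that average to the fractional part of `x` gives points of `P(h,u)` averaging to `x`. It
needs neither skew supermodularity nor the terminals.

Half-integrality is proved for `x` directly. An extreme point is determined by its integral
coordinates together with its tight cuts of positive demand (`eq_zero_of_mem_extremePoints`). The
terminals dictate how two such bisets uncross: the same terminal forces intersection and union,
different terminals force the two differences. Hence a maximal non-crossing family `L` of tight
bisets already determines all tight cuts (`sum_bisetCut_eq_zero_of_maximal`).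

Members of `L` with a common terminal form a chain, and those with different terminals are strongly
disjoint. Replacing each cut vector by its difference with that of its predecessor in the chain
gives an equivalent system with entries in {-1, 0, 1} and integral right-hand sides. An edge meets
at most two of the new rows, since it can enter or leave cuts only at two members of `L` altogether.
Counting and rounding (`half_integral_of_two_nonzero_per_column`) then show that such a system has a
half-integral solution. -/

/-- A system with coefficients in `{-1, 0, 1}`, at most two nonzero coefficients per column and
integral right-hand side, which determines the non-integral coordinates of `x`, forces `x` to be
half-integral. -/
theorem half_integral_of_two_nonzero_per_column {ι E : Type*} [Fintype ι] [Fintype E]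
    (A : ι → E → ℤ) (x : E → ℚ) (hA : ∀ i e, |A i e| ≤ 1)
    (hcol : ∀ e, (Finset.univ.filter fun i => A i e ≠ 0).card ≤ 2)
    (hint : ∀ i, ∃ k : ℤ, ∑ e, (A i e : ℚ) * x e = k)
    (hinj : ∀ z : E → ℚ, (∀ e, (∃ k : ℤ, x e = k) → z e = 0) →
      (∀ i, ∑ e, (A i e : ℚ) * z e = 0) → z = 0) (e : E) :
    ∃ k : ℤ, x e = (k : ℚ) / 2 := by
  classical
  set F : Finset E := Finset.univ.filter fun e => ¬ ∃ k : ℤ, x e = k with hF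
  set r : E → ℚ := fun e => x e - round (x e) with hr
  have hr_half : ∀ e, |r e| ≤ 1 / 2 := fun e => abs_sub_round (x e)
  have hr_int : ∀ e, e ∉ F → r e = 0 := by
    intro e he
    simp only [hF, Finset.mem_filter, Finset.mem_univ, true_and, not_not] at he
    obtain ⟨k, hk⟩ := he
    simp [hr, hk]
  have hr_ne : ∀ e, e ∈ F → r e ≠ 0 := by
    intro e he h0
    simp only [hF, Finset.mem_filter, Finset.mem_univ, true_and] at he
    exact he ⟨round (x e), by simp only [hr] at h0; linarith⟩
  have hrow : ∀ i, ∃ k : ℤ, ∑ e ∈ F, (A i e : ℚ) * r e = k := by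
    intro i
    obtain ⟨k, hk⟩ := hint i
    refine ⟨k - ∑ e, A i e * round (x e), ?_⟩
    have h1 : ∑ e ∈ F, (A i e : ℚ) * r e = ∑ e, (A i e : ℚ) * r e :=
      Finset.sum_subset (Finset.subset_univ _) fun e _ he => by rw [hr_int e he, mul_zero]
    rw [h1]
    push_cast
    rw [← hk, ← Finset.sum_sub_distrib]
    exact Finset.sum_congr rfl fun e _ => by simp only [hr]; ring
  set N : ι → Finset E := fun i => F.filter fun e => A i e ≠ 0 with hN
  have hrowN : ∀ i, ∀ z : E → ℚ, ∑ e ∈ F, (A i e : ℚ) * z e = ∑ e ∈ N i, (A i e : ℚ) * z e := by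
    intro i z
    refine (Finset.sum_subset (Finset.filter_subset _ _) fun e he he' => ?_).symm
    have : A i e = 0 := by
      by_contra h
      exact he' (Finset.mem_filter.2 ⟨he, h⟩)
    simp [this]
  have hunit : ∀ i e, e ∈ N i → A i e = 1 ∨ A i e = -1 := by
    intro i e he
    have h1 := abs_le.1 (hA i e)
    have h2 := (Finset.mem_filter.1 he).2
    omega
  set R : Finset ι := Finset.univ.filter fun i => (N i).Nonempty with hR
  -- A row with a single entry would make `±r f` an integer of modulus at most 1/2, hence 0,
  -- although `f` is a fractional coordinate.
  have hN_two : ∀ i ∈ R, 2 ≤ (N i).card := by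
    intro i hi
    by_contra hlt
    have hpos : 0 < (N i).card := Finset.card_pos.2 (Finset.mem_filter.1 hi).2
    obtain ⟨f, hf⟩ := Finset.card_eq_one.1 (by omega : (N i).card = 1)
    obtain ⟨k, hk⟩ := hrow i
    rw [hrowN, hf, Finset.sum_singleton] at hk
    have hfN : f ∈ N i := by simp [hf]
    have hfF := (Finset.mem_filter.1 hfN).1
    have hab : |(k : ℚ)| < 1 := by
      have := hr_half f
      rcases hunit i f hfN with h | h <;> rw [← hk, h] <;> simp <;> linarith
    have hk0 : k = 0 := by
      rw [← Int.abs_lt_one_iff]; exact_mod_cast hab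
    rw [hk0] at hk
    have := hr_ne f hfF
    rcases hunit i f hfN with h | h <;> rw [h] at hk <;> simp at hk <;> exact this hk
  have hcard : F.card ≤ R.card := by
    let M : (F → ℚ) →ₗ[ℚ] (R → ℚ) := Matrix.mulVecLin (Matrix.of fun i e => (A i.1 e.1 : ℚ))
    have hM : Function.Injective M := by
      rw [← LinearMap.ker_eq_bot, LinearMap.ker_eq_bot']
      intro z hz
      let w : E → ℚ := fun e => if he : e ∈ F then z ⟨e, he⟩ else 0
      have hw : w = 0 := by
        apply hinj
        · intro e he
          have : e ∉ F := by simp [hF, he]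
          simp [w, this]
        · intro i
          have h1 : ∑ e, (A i e : ℚ) * w e = ∑ e ∈ F, (A i e : ℚ) * w e :=
            (Finset.sum_subset (Finset.subset_univ _) fun e _ he => by simp [w, he]).symm
          by_cases hi : i ∈ R
          · have h2 := congrFun hz ⟨i, hi⟩
            simp only [M, Matrix.mulVecLin_apply, Matrix.mulVec, dotProduct, Matrix.of_apply,
              Pi.zero_apply] at h2
            rw [h1, ← Finset.sum_coe_sort, ← h2]
            exact Finset.sum_congr rfl fun e _ => by simp [w]
          · have : N i = ∅ := by
              by_contra h
              exact hi (Finset.mem_filter.2 ⟨Finset.mem_univ _, Finset.nonempty_iff_ne_empty.2 h⟩)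
            rw [h1, hrowN, this, Finset.sum_empty]
      ext e
      have := congrFun hw e.1
      simpa [w] using this
    have := LinearMap.finrank_le_finrank_of_injective hM
    simpa using this
  have hdouble : ∑ i ∈ R, (N i).card ≤ F.card * 2 := by
    have h1 : ∑ i ∈ R, (N i).card = ∑ e ∈ F, (R.filter fun i => A i e ≠ 0).card := by
      simp only [hN, Finset.card_filter]
      exact Finset.sum_comm
    rw [h1]
    refine Finset.sum_le_card_nsmul _ _ _ fun e _ => ?_
    exact (Finset.card_le_card (Finset.filter_subset_filter _ (Finset.subset_univ _))).trans (hcol e)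
  -- All bounds are tight: 2|R| ≤ ∑ |N i| ≤ 2|F| ≤ 2|R|.
  have hN_eq : ∀ i ∈ R, (N i).card = 2 := by
    by_contra! hne
    obtain ⟨i, hi, hne⟩ := hne
    have : ∑ i ∈ R, 2 < ∑ i ∈ R, (N i).card :=
      Finset.sum_lt_sum hN_two ⟨i, hi, lt_of_le_of_ne (hN_two i hi) (Ne.symm hne)⟩
    simp only [Finset.sum_const, smul_eq_mul] at this
    omega
  -- Erasing the entries of modulus exactly 1/2 leaves a kernel vector: if one of the two entries of
  -- a row is smaller than 1/2, their signed sum is an integer of modulus below 1, so it is 0 and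
  -- both moduli agree. Thus each row keeps both entries or loses both.
  set z : E → ℚ := fun e => if |r e| < 1 / 2 then r e else 0 with hz
  have hz0 : z = 0 := by
    have hzF : ∀ e, e ∉ F → z e = 0 := fun e he => by simp [hz, hr_int e he]
    apply hinj
    · intro e he
      exact hzF e (by simp [hF, he])
    · intro i
      have h1 : ∑ e, (A i e : ℚ) * z e = ∑ e ∈ F, (A i e : ℚ) * z e :=
        (Finset.sum_subset (Finset.subset_univ _) fun e _ he => by simp [hzF e he]).symm
      rw [h1, hrowN]
      by_cases hi : i ∈ R
      · obtain ⟨f, g, hfg, hNi⟩ := Finset.card_eq_two.1 (hN_eq i hi)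
        obtain ⟨k, hk⟩ := hrow i
        rw [hrowN, hNi, Finset.sum_pair hfg] at hk
        rw [hNi, Finset.sum_pair hfg]
        have hf := hr_half f
        have hg := hr_half g
        have key : |r f| < 1 / 2 ∨ |r g| < 1 / 2 →
            (A i f : ℚ) * r f + A i g * r g = 0 ∧ |r f| = |r g| := by
          intro hlt
          have hab : |(k : ℚ)| < 1 := by
            rw [← hk]
            refine (abs_add_le _ _).trans_lt ?_
            have hAf : |(A i f : ℚ)| = 1 := by
              rcases hunit i f (by simp [hNi]) with h | h <;> simp [h]
            have hAg : |(A i g : ℚ)| = 1 := by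
              rcases hunit i g (by simp [hNi]) with h | h <;> simp [h]
            rw [abs_mul, abs_mul, hAf, hAg]
            rcases hlt with h | h <;> linarith
          have hk0 : k = 0 := by
            rw [← Int.abs_lt_one_iff]; exact_mod_cast hab
          rw [hk0, Int.cast_zero] at hk
          refine ⟨hk, ?_⟩
          rw [abs_eq_abs]
          rcases hunit i f (by simp [hNi]) with h | h <;>
            rcases hunit i g (by simp [hNi]) with h' | h' <;> rw [h, h'] at hk <;>
            push_cast at hk
          · right; linarith
          · left; linarith
          · left; linarith
          · right; linarith
        by_cases hlt : |r f| < 1 / 2 ∨ |r g| < 1 / 2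
        · obtain ⟨h2, h3⟩ := key hlt
          have hf' : |r f| < 1 / 2 := by
            rcases hlt with h | h
            · exact h
            · rwa [h3]
          have hg' : |r g| < 1 / 2 := h3 ▸ hf'
          simp only [hz, hf', hg', if_true]
          exact h2
        · rw [not_or] at hlt
          simp only [hz, hlt.1, hlt.2, if_false, mul_zero, add_zero]
      · have : N i = ∅ := by
          by_contra h
          exact hi (Finset.mem_filter.2 ⟨Finset.mem_univ _, Finset.nonempty_iff_ne_empty.2 h⟩)
        rw [this, Finset.sum_empty]
  have hze := congrFun hz0 e
  simp only [hz, Pi.zero_apply] at hze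
  split_ifs at hze with hlt
  · refine ⟨2 * round (x e), ?_⟩
    simp only [hr] at hze
    push_cast
    linarith
  · have heq : |r e| = 1 / 2 := le_antisymm (hr_half e) (not_lt.1 hlt)
    rcases (abs_eq (by norm_num)).1 heq with h | h
    · refine ⟨2 * round (x e) + 1, ?_⟩
      simp only [hr] at h
      push_cast
      linarith
    · refine ⟨2 * round (x e) - 1, ?_⟩
      simp only [hr] at h
      push_cast
      linarith

/-! ### Non-crossing bisets and their terminals. -/

namespace Biset

instance {V : Type*} : PartialOrder (Biset V) :=
  PartialOrder.lift (fun X => (X.inner, X.outer)) fun _ _ h =>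
    Biset.ext (congrArg Prod.fst h) (congrArg Prod.snd h)

instance {V : Type*} [Finite V] : Finite (Biset V) :=
  Finite.of_injective (fun X : Biset V => (X.inner, X.outer)) fun _ _ h =>
    Biset.ext (congrArg Prod.fst h) (congrArg Prod.snd h)

/-- The biset with empty inner and outer part. -/
def empty (V : Type*) : Biset V := ⟨∅, ∅, subset_rfl⟩

/-- Each inner part is disjoint from the other outer part. -/
def StronglyDisjoint {V : Type*} (X Y : Biset V) : Prop :=
  Disjoint X.inner Y.outer ∧ Disjoint X.outer Y.inner

/-- Two bisets do not cross if they are comparable or strongly disjoint. -/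
def NonCrossing {V : Type*} (X Y : Biset V) : Prop :=
  X ≤ Y ∨ Y ≤ X ∨ X.StronglyDisjoint Y

variable {V : Type*} [DecidableEq V]

/-- `t` is the only terminal of the inner part and of the outer part of the biset. -/
def SeparatesAt (T : Finset V) (t : V) (X : Biset V) : Prop :=
  X.inner ∩ T = {t} ∧ X.outer ∩ T = {t}

variable {T : Finset V} {X Y Z : Biset V} {s t r : V}

theorem NonCrossing.symm {V : Type*} {X Y : Biset V} (hXY : X.NonCrossing Y) : Y.NonCrossing X := by
  rcases hXY with h | h | h
  · exact Or.inr (Or.inl h)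
  · exact Or.inl h
  · exact Or.inr (Or.inr ⟨h.2.symm, h.1.symm⟩)

theorem SeparatesAt.mem (hX : X.SeparatesAt T t) : t ∈ X.inner ∧ t ∈ X.outer ∧ t ∈ T := by
  have h1 : t ∈ X.inner ∩ T := by simp [hX.1]
  have h2 := Finset.mem_inter.1 h1
  exact ⟨h2.1, X.inner_subset_outer h2.1, h2.2⟩

theorem SeparatesAt.eq_of_mem (hX : X.SeparatesAt T t) (hs : s ∈ X.outer) (hsT : s ∈ T) :
    s = t := by
  have h1 : s ∈ X.outer ∩ T := Finset.mem_inter.2 ⟨hs, hsT⟩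
  rwa [hX.2, Finset.mem_singleton] at h1

theorem SeparatesAt.eq_of_le (hX : X.SeparatesAt T t) (hY : Y.SeparatesAt T s) (hXY : X ≤ Y) :
    t = s :=
  hY.eq_of_mem (hXY.2 hX.mem.2.1) hX.mem.2.2

theorem SeparatesAt.not_stronglyDisjoint (hX : X.SeparatesAt T t) (hY : Y.SeparatesAt T t) :
    ¬ X.StronglyDisjoint Y := fun h =>
  Finset.disjoint_left.1 h.1 hX.mem.1 hY.mem.2.1

theorem SeparatesAt.le_or_le (hX : X.SeparatesAt T t) (hY : Y.SeparatesAt T t)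
    (h : X.NonCrossing Y) : X ≤ Y ∨ Y ≤ X := by
  rcases h with h | h | h
  · exact Or.inl h
  · exact Or.inr h
  · exact absurd h (hX.not_stronglyDisjoint hY)

theorem SeparatesAt.stronglyDisjoint (hX : X.SeparatesAt T t) (hY : Y.SeparatesAt T s)
    (hts : t ≠ s) (h : X.NonCrossing Y) : X.StronglyDisjoint Y := by
  rcases h with h | h | h
  · exact absurd (hX.eq_of_le hY h) hts
  · exact absurd (hY.eq_of_le hX h).symm hts
  · exact h

theorem inter_le_left : X.inter Y ≤ X := ⟨Finset.inter_subset_left, Finset.inter_subset_left⟩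

theorem inter_le_right : X.inter Y ≤ Y := ⟨Finset.inter_subset_right, Finset.inter_subset_right⟩

theorem le_inter (hX : Z ≤ X) (hY : Z ≤ Y) : Z ≤ X.inter Y :=
  ⟨Finset.subset_inter hX.1 hY.1, Finset.subset_inter hX.2 hY.2⟩

theorem le_union_left : X ≤ X.union Y := ⟨Finset.subset_union_left, Finset.subset_union_left⟩

theorem le_union_right : Y ≤ X.union Y := ⟨Finset.subset_union_right, Finset.subset_union_right⟩

theorem union_le (hX : X ≤ Z) (hY : Y ≤ Z) : X.union Y ≤ Z :=
  ⟨Finset.union_subset hX.1 hY.1, Finset.union_subset hX.2 hY.2⟩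

theorem diff_le_left : X.diff Y ≤ X := ⟨Finset.sdiff_subset, Finset.sdiff_subset⟩

theorem stronglyDisjoint_diff_right : Y.StronglyDisjoint (X.diff Y) :=
  ⟨Finset.disjoint_sdiff, Finset.disjoint_sdiff⟩

theorem le_diff (hX : Z ≤ X) (hY : Z.StronglyDisjoint Y) : Z ≤ X.diff Y :=
  ⟨Finset.subset_sdiff.2 ⟨hX.1, hY.1⟩, Finset.subset_sdiff.2 ⟨hX.2, hY.2⟩⟩

theorem StronglyDisjoint.mono_right {V : Type*} {X Y Z : Biset V} (h : Z.StronglyDisjoint X) (hYX : Y ≤ X) :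
    Z.StronglyDisjoint Y :=
  ⟨h.1.mono_right hYX.2, h.2.mono_right hYX.1⟩

theorem StronglyDisjoint.union_right (hX : Z.StronglyDisjoint X) (hY : Z.StronglyDisjoint Y) :
    Z.StronglyDisjoint (X.union Y) :=
  ⟨Finset.disjoint_union_right.2 ⟨hX.1, hY.1⟩, Finset.disjoint_union_right.2 ⟨hX.2, hY.2⟩⟩

/-- A biset that crosses neither of two crossing bisets with the same terminal does not cross
their intersection or their union. -/
theorem NonCrossing.inter_and_union (hX : X.SeparatesAt T t) (hY : Y.SeparatesAt T t)
    (hZ : Z.SeparatesAt T r) (hXY : ¬ X.NonCrossing Y) (hZX : Z.NonCrossing X)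
    (hZY : Z.NonCrossing Y) :
    Z.NonCrossing (X.inter Y) ∧ Z.NonCrossing (X.union Y) := by
  by_cases hr : r = t
  · subst hr
    rcases hZ.le_or_le hX hZX with h1 | h1 <;> rcases hZ.le_or_le hY hZY with h2 | h2
    · exact ⟨Or.inl (le_inter h1 h2), Or.inl (h1.trans le_union_left)⟩
    -- A biset lying between `X` and `Y` would make them comparable, against crossing.
    · exact absurd (Or.inr (Or.inl (h2.trans h1))) hXY
    · exact absurd (Or.inl (h1.trans h2)) hXY
    · exact ⟨Or.inr (Or.inl (inter_le_left.trans h1)), Or.inr (Or.inl (union_le h1 h2))⟩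
  · have h1 := hZ.stronglyDisjoint hX hr hZX
    have h2 := hZ.stronglyDisjoint hY hr hZY
    exact ⟨Or.inr (Or.inr (h1.mono_right inter_le_left)), Or.inr (Or.inr (h1.union_right h2))⟩

/-- A biset that crosses neither of two bisets with different terminals does not cross their
difference. -/
theorem NonCrossing.diff (hX : X.SeparatesAt T t) (hY : Y.SeparatesAt T s)
    (hZ : Z.SeparatesAt T r) (hts : t ≠ s) (hZX : Z.NonCrossing X) (hZY : Z.NonCrossing Y) :
    Z.NonCrossing (X.diff Y) := by
  by_cases hr : r = t
  · subst hr
    have h2 := hZ.stronglyDisjoint hY hts hZY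
    rcases hZ.le_or_le hX hZX with h1 | h1
    · exact Or.inl (le_diff h1 h2)
    · exact Or.inr (Or.inl (diff_le_left.trans h1))
  · exact Or.inr (Or.inr ((hZ.stronglyDisjoint hX hr hZX).mono_right diff_le_left))

end Biset

/-! ### Submodularity of cuts. -/

section Cut

variable {V E : Type*} [Fintype E] {ends : E → Sym2 V}

theorem mem_bisetCut_iff {X : Biset V} {e : E} {a b : V} (he : ends e = s(a, b)) :
    e ∈ bisetCut ends X ↔ (a ∈ X.inner ∧ b ∉ X.outer) ∨ (b ∈ X.inner ∧ a ∉ X.outer) := by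
  simp only [bisetCut, Finset.mem_filter, Finset.mem_univ, true_and, he]
  constructor
  · rintro ⟨c, d, hcd, h1, h2⟩
    rcases Sym2.eq_iff.1 hcd with ⟨rfl, rfl⟩ | ⟨rfl, rfl⟩
    · exact Or.inl ⟨h1, h2⟩
    · exact Or.inr ⟨h1, h2⟩
  · rintro (⟨h1, h2⟩ | ⟨h1, h2⟩)
    · exact ⟨a, b, rfl, h1, h2⟩
    · exact ⟨b, a, Sym2.eq_swap, h1, h2⟩

open Classical in
/-- The incidence of an edge with the cut of a biset. -/
noncomputable def cutIndicator (ends : E → Sym2 V) (X : Biset V) (e : E) : ℤ :=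
  if e ∈ bisetCut ends X then 1 else 0

theorem sum_bisetCut (X : Biset V) (w : E → ℚ) :
    ∑ e ∈ bisetCut ends X, w e = ∑ e, (cutIndicator ends X e : ℚ) * w e := by
  classical
  simp [cutIndicator, Finset.sum_ite_mem]

variable [DecidableEq V]

/-- Stated edge by edge, not for sums, because uncrossing needs equality on every edge of the
support of `x`. The proof checks all positions of the two end nodes. -/
theorem cutIndicator_inter_add_union_le (X Y : Biset V) (e : E) :
    cutIndicator ends (X.inter Y) e + cutIndicator ends (X.union Y) e ≤
      cutIndicator ends X e + cutIndicator ends Y e := by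
  obtain ⟨a, b, he⟩ : ∃ a b, ends e = s(a, b) := by
    induction h : ends e with | _ a b => exact ⟨a, b, rfl⟩
  have := @X.inner_subset_outer a
  have := @X.inner_subset_outer b
  have := @Y.inner_subset_outer a
  have := @Y.inner_subset_outer b
  simp only [cutIndicator, mem_bisetCut_iff he, Biset.inter, Biset.union, Finset.mem_inter,
    Finset.mem_union]
  grind

theorem cutIndicator_diff_add_diff_le (X Y : Biset V) (e : E) :
    cutIndicator ends (X.diff Y) e + cutIndicator ends (Y.diff X) e ≤
      cutIndicator ends X e + cutIndicator ends Y e := by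
  obtain ⟨a, b, he⟩ : ∃ a b, ends e = s(a, b) := by
    induction h : ends e with | _ a b => exact ⟨a, b, rfl⟩
  have := @X.inner_subset_outer a
  have := @X.inner_subset_outer b
  have := @Y.inner_subset_outer a
  have := @Y.inner_subset_outer b
  simp only [cutIndicator, mem_bisetCut_iff he, Biset.diff, Finset.mem_sdiff]
  grind

end Cut

/-! ### Each edge changes its cut status at most twice along the chains. -/

section Chains

variable {V E : Type*} [Fintype E] {ends : E → Sym2 V}

theorem cutIndicator_empty (e : E) : cutIndicator ends (Biset.empty V) e = 0 := by
  simp [cutIndicator, bisetCut, Biset.empty]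

theorem cutIndicator_nonneg (X : Biset V) (e : E) : 0 ≤ cutIndicator ends X e := by
  unfold cutIndicator; split_ifs <;> simp

theorem cutIndicator_le_one (X : Biset V) (e : E) : cutIndicator ends X e ≤ 1 := by
  unfold cutIndicator; split_ifs <;> simp

/-- `p` maps each member of the family `L` to its greatest proper subset in `L`, or to the empty
biset if there is none. -/
def IsPredecessor (L : Finset (Biset V)) (p : Biset V → Biset V) : Prop :=
  ∀ X ∈ L, ((p X ∈ L ∧ p X < X) ∨ p X = Biset.empty V) ∧ ∀ Y ∈ L, Y < X → Y ≤ p X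

theorem IsPredecessor.le {L : Finset (Biset V)} {p : Biset V → Biset V} (hp : IsPredecessor L p)
    {X : Biset V} (hX : X ∈ L) : p X ≤ X := by
  rcases (hp X hX).1 with h | h
  · exact h.2.le
  · rw [h]
    exact ⟨Finset.empty_subset _, Finset.empty_subset _⟩

/-- Members below `X` share its terminal, so they are totally ordered and a maximal one is the
greatest. -/
theorem exists_isPredecessor [DecidableEq V] {T : Finset V} {L : Finset (Biset V)}
    (hL : ∀ X ∈ L, ∃ t, X.SeparatesAt T t) (hNC : ∀ X ∈ L, ∀ Y ∈ L, X.NonCrossing Y) :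
    ∃ p, IsPredecessor L p := by
  classical
  have key : ∀ X, ∃ P, X ∈ L →
      ((P ∈ L ∧ P < X) ∨ P = Biset.empty V) ∧ ∀ Y ∈ L, Y < X → Y ≤ P := by
    intro X
    by_cases hX : X ∈ L
    · by_cases hne : (L.filter fun Y => Y < X).Nonempty
      · obtain ⟨P, hP, hmax⟩ := (L.filter fun Y => Y < X).exists_maximal hne
        rw [Finset.mem_filter] at hP
        refine ⟨P, fun _ => ⟨Or.inl hP, fun Y hY hYX => ?_⟩⟩
        obtain ⟨t, ht⟩ := hL X hX
        obtain ⟨s, hs⟩ := hL Y hY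
        obtain ⟨r, hr⟩ := hL P hP.1
        obtain rfl := hs.eq_of_le ht hYX.le
        obtain rfl := hr.eq_of_le ht hP.2.le
        rcases hs.le_or_le hr (hNC Y hY P hP.1) with h | h
        · exact h
        · exact hmax (Finset.mem_filter.2 ⟨hY, hYX⟩) h
      · refine ⟨Biset.empty V, fun _ => ⟨Or.inr rfl, fun Y hY hYX => ?_⟩⟩
        exact absurd ⟨Y, Finset.mem_filter.2 ⟨hY, hYX⟩⟩ hne
    · exact ⟨X, fun h => absurd h hX⟩
  choose p hp using key
  exact ⟨p, hp⟩

/-- The biset is the first of its chain to have `a` in its inner part, and does not reach `b`. -/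
def Starts (p : Biset V → Biset V) (a b : V) (X : Biset V) : Prop :=
  a ∈ X.inner ∧ b ∉ X.outer ∧ a ∉ (p X).inner

/-- The biset is the first of its chain to reach `b`, its predecessor having `a` inside. -/
def Stops (p : Biset V → Biset V) (a b : V) (X : Biset V) : Prop :=
  a ∈ (p X).inner ∧ b ∉ (p X).outer ∧ b ∈ X.outer

variable {L : Finset (Biset V)} {p : Biset V → Biset V} {X Y : Biset V} {a b : V}

theorem Biset.NonCrossing.le_or_le_of_mem (h : X.NonCrossing Y) (hX : a ∈ X.outer)
    (hY : a ∈ Y.inner) : X ≤ Y ∨ Y ≤ X := by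
  rcases h with h | h | h
  · exact Or.inl h
  · exact Or.inr h
  · exact absurd hY (Finset.disjoint_left.1 h.2 hX)

theorem IsPredecessor.eq_of_le_or_le (hp : IsPredecessor L p) (hX : X ∈ L) (hY : Y ∈ L)
    (h : X ≤ Y ∨ Y ≤ X) (hXY : ¬ X ≤ p Y) (hYX : ¬ Y ≤ p X) : X = Y := by
  by_contra hne
  rcases h with h | h
  · exact hXY ((hp Y hY).2 X hX (lt_of_le_of_ne h hne))
  · exact hYX ((hp X hX).2 Y hY (lt_of_le_of_ne h (Ne.symm hne)))

/-- Two such bisets share `a`, so they are comparable. If they differed, the smaller would lie below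
the predecessor of the larger, which would then already have `a` inside. -/
theorem Starts.unique (hp : IsPredecessor L p) (hX : X ∈ L) (hY : Y ∈ L)
    (hXY : X.NonCrossing Y) (h : Starts p a b X) (h' : Starts p a b Y) : X = Y :=
  hp.eq_of_le_or_le hX hY (hXY.le_or_le_of_mem (X.inner_subset_outer h.1) h'.1)
    (fun hle => h'.2.2 (hle.1 h.1)) (fun hle => h.2.2 (hle.1 h'.1))

theorem Stops.unique (hp : IsPredecessor L p) (hX : X ∈ L) (hY : Y ∈ L)
    (hXY : X.NonCrossing Y) (h : Stops p a b X) (h' : Stops p a b Y) : X = Y :=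
  hp.eq_of_le_or_le hX hY
    (hXY.le_or_le_of_mem ((hp.le hX).2 ((p X).inner_subset_outer h.1)) ((hp.le hY).1 h'.1))
    (fun hle => h'.2.1 (hle.2 h.2.2)) (fun hle => h.2.1 (hle.2 h'.2.2))

/-- Both bisets contain `b`, so they are comparable. If `X ≤ Y`, then `a` gets into `Y`; if `Y < X`,
then `b` is already reached by the predecessor of `X`. -/
theorem Stops.false_of_mem (hp : IsPredecessor L p) (hX : X ∈ L) (hY : Y ∈ L)
    (hXY : X.NonCrossing Y) (h : Stops p a b X) (hb : b ∈ Y.inner) (ha : a ∉ Y.outer) :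
    False := by
  have haX : a ∈ X.inner := (hp.le hX).1 h.1
  rcases hXY.le_or_le_of_mem h.2.2 hb with hle | hle
  · exact ha (hle.2 (X.inner_subset_outer haX))
  · have hne : Y ≠ X := by
      rintro rfl
      exact ha (Y.inner_subset_outer haX)
    exact h.2.1 (((hp X hX).2 Y hY (lt_of_le_of_ne hle hne)).2 (Y.inner_subset_outer hb))

theorem Stops.false_of_stops (hp : IsPredecessor L p) (hNC : ∀ X ∈ L, ∀ Y ∈ L, X.NonCrossing Y)
    (hX : X ∈ L) (hY : Y ∈ L) (h : Stops p a b X) (h' : Stops p b a Y) : False := by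
  rcases (hp Y hY).1 with hpY | hpY
  · exact h.false_of_mem hp hX hpY.1 (hNC _ hX _ hpY.1) h'.1 h'.2.1
  · have := h'.1
    rw [hpY] at this
    exact absurd this (Finset.notMem_empty _)

theorem starts_or_stops_of_cutIndicator_ne (hp : IsPredecessor L p) (hX : X ∈ L) {e : E}
    (he : ends e = s(a, b)) (hne : cutIndicator ends X e - cutIndicator ends (p X) e ≠ 0) :
    Starts p a b X ∨ Starts p b a X ∨ Stops p a b X ∨ Stops p b a X := by
  have h1 := @(hp.le hX).1 a
  have h2 := @(hp.le hX).1 b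
  have h3 := @(hp.le hX).2 a
  have h4 := @(hp.le hX).2 b
  have hne' : ¬ (e ∈ bisetCut ends X ↔ e ∈ bisetCut ends (p X)) := fun h => hne (by
    by_cases h' : e ∈ bisetCut ends X
    · simp [cutIndicator, h', h.1 h']
    · simp [cutIndicator, h', mt h.2 h'])
  rw [mem_bisetCut_iff he, mem_bisetCut_iff he] at hne'
  clear hne he hp hX
  unfold Starts Stops
  dsimp only at h1 h2 h3 h4
  grind

/-- Four classes of at most one element each, only two of which can be occupied together, cannot
cover three elements. -/
theorem false_of_four_classes {α : Type*} {S S' R R' : α → Prop} {X Y Z : α}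
    (hS : ∀ x y, S x → S y → x = y) (hS' : ∀ x y, S' x → S' y → x = y)
    (hR : ∀ x y, R x → R y → x = y) (hR' : ∀ x y, R' x → R' y → x = y)
    (hRS : ∀ x y, R x → S' y → False) (hRS' : ∀ x y, R' x → S y → False)
    (hRR : ∀ x y, R x → R' y → False) (hXY : X ≠ Y) (hXZ : X ≠ Z) (hYZ : Y ≠ Z)
    (hX : S X ∨ S' X ∨ R X ∨ R' X) (hY : S Y ∨ S' Y ∨ R Y ∨ R' Y)
    (hZ : S Z ∨ S' Z ∨ R Z ∨ R' Z) : False := by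
  grind

/-- Each change is a start or a stop, oriented from `a` or from `b`, and each of these four kinds
occurs at most once. A stop excludes the start and the stop of opposite orientation, so at most two
kinds coexist. -/
theorem card_cutIndicator_sub_ne_zero_le_two (hp : IsPredecessor L p)
    (hNC : ∀ X ∈ L, ∀ Y ∈ L, X.NonCrossing Y) (e : E) :
    (Finset.univ.filter fun X : L =>
      cutIndicator ends X.1 e - cutIndicator ends (p X.1) e ≠ 0).card ≤ 2 := by
  obtain ⟨a, b, he⟩ : ∃ a b, ends e = s(a, b) := by
    induction h : ends e with | _ a b => exact ⟨a, b, rfl⟩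
  have classes : ∀ X : L, cutIndicator ends X.1 e - cutIndicator ends (p X.1) e ≠ 0 →
      Starts p a b X.1 ∨ Starts p b a X.1 ∨ Stops p a b X.1 ∨ Stops p b a X.1 :=
    fun X => starts_or_stops_of_cutIndicator_ne hp X.2 he
  have uniqueStart : ∀ c d, ∀ X Y : L, Starts p c d X.1 → Starts p c d Y.1 → X = Y :=
    fun c d X Y h h' => Subtype.ext (h.unique hp X.2 Y.2 (hNC _ X.2 _ Y.2) h')
  have uniqueStop : ∀ c d, ∀ X Y : L, Stops p c d X.1 → Stops p c d Y.1 → X = Y :=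
    fun c d X Y h h' => Subtype.ext (h.unique hp X.2 Y.2 (hNC _ X.2 _ Y.2) h')
  have stopStart : ∀ c d, ∀ X Y : L, Stops p c d X.1 → Starts p d c Y.1 → False :=
    fun c d X Y h h' => h.false_of_mem hp X.2 Y.2 (hNC _ X.2 _ Y.2) h'.1 h'.2.1
  have stopStop : ∀ X Y : L, Stops p a b X.1 → Stops p b a Y.1 → False :=
    fun X Y h h' => h.false_of_stops hp hNC X.2 Y.2 h'
  by_contra hlt
  obtain ⟨X, hX, Y, hY, Z, hZ, hXY, hXZ, hYZ⟩ := Finset.two_lt_card.1 (not_le.1 hlt)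
  have hX := classes X (Finset.mem_filter.1 hX).2
  have hY := classes Y (Finset.mem_filter.1 hY).2
  have hZ := classes Z (Finset.mem_filter.1 hZ).2
  exact false_of_four_classes (S := fun X : L => Starts p a b X.1)
    (S' := fun X : L => Starts p b a X.1) (R := fun X : L => Stops p a b X.1)
    (R' := fun X : L => Stops p b a X.1) (uniqueStart a b) (uniqueStart b a) (uniqueStop a b)
    (uniqueStop b a) (stopStart a b) (stopStart b a) stopStop hXY hXZ hYZ hX hY hZ

end Chains

/-! ### Uncrossing tight bisets. -/

namespace BisetFunction

variable {V E : Type*} [DecidableEq V] [Fintype E] {ends : E → Sym2 V} {T : Finset V}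
  {h : BisetFunction V} {u : E → ℕ} {x : E → ℚ} {X Y A B : Biset V}

theorem value_coe {V : Type*} (h : BisetFunction V) (X : NonemptyBiset V) : h.value X.1 = h X := dif_pos X.2

theorem exists_of_value_pos {V : Type*} {h : BisetFunction V} {X : Biset V} (hX : 0 < h.value X) : ∃ Y : NonemptyBiset V, Y.1 = X := by
  unfold value at hX
  split_ifs at hX with hne
  · exact ⟨⟨X, hne⟩, rfl⟩
  · exact absurd hX (lt_irrefl _)

theorem exists_separatesAt (hpos : ∀ X : NonemptyBiset V, 0 < h X → X ∈ terminalBisets T)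
    (hX : 0 < h.value X) : ∃ t, X.SeparatesAt T t := by
  obtain ⟨Y, rfl⟩ := exists_of_value_pos hX
  rw [value_coe h] at hX
  obtain ⟨t, -, ht⟩ := Set.mem_iUnion₂.1 (hpos Y hX)
  exact ⟨t, ht⟩

theorem value_le_of_mem {V : Type*} {ends : E → Sym2 V} {h : BisetFunction V}
    (hx : x ∈ coverPolyhedron ends h u) (X : Biset V) :
    h.value X ≤ ((∑ e ∈ bisetCut ends X, x e : ℚ) : ℝ) := by
  by_cases hX : X.inner.Nonempty
  · exact (value_coe h ⟨X, hX⟩).trans_le (hx.2.1 ⟨X, hX⟩)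
  · rw [value, dif_neg hX]
    exact_mod_cast Finset.sum_nonneg fun e _ => hx.1 e

/-- The covering constraint of the biset is tight and has a positive right-hand side. -/
def IsTight (ends : E → Sym2 V) (h : BisetFunction V) (x : E → ℚ) (X : Biset V) : Prop :=
  h.value X = ((∑ e ∈ bisetCut ends X, x e : ℚ) : ℝ) ∧ 0 < h.value X

/-- If two tight bisets are replaced by bisets with no smaller demand and no larger incidence
vector, then all inequalities involved hold with equality. -/
theorem IsTight.uncross (hx : x ∈ coverPolyhedron ends h u) (hX : IsTight ends h x X)
    (hY : IsTight ends h x Y) (hval : h.value X + h.value Y ≤ h.value A + h.value B)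
    (hcut : ∀ e, cutIndicator ends A e + cutIndicator ends B e ≤
      cutIndicator ends X e + cutIndicator ends Y e) :
    h.value A = ((∑ e ∈ bisetCut ends A, x e : ℚ) : ℝ) ∧
    h.value B = ((∑ e ∈ bisetCut ends B, x e : ℚ) : ℝ) ∧
    ∀ e, x e ≠ 0 → cutIndicator ends A e + cutIndicator ends B e =
      cutIndicator ends X e + cutIndicator ends Y e := by
  have hA := value_le_of_mem hx A
  have hB := value_le_of_mem hx B
  have hterm : ∀ e ∈ Finset.univ, (0 : ℚ) ≤ ((cutIndicator ends X e + cutIndicator ends Y e -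
      (cutIndicator ends A e + cutIndicator ends B e) : ℤ) : ℚ) * x e := by
    intro e _
    exact mul_nonneg (by exact_mod_cast sub_nonneg.2 (hcut e)) (hx.1 e)
  have hsum : ∑ e, ((cutIndicator ends X e + cutIndicator ends Y e -
      (cutIndicator ends A e + cutIndicator ends B e) : ℤ) : ℚ) * x e =
      ∑ e ∈ bisetCut ends X, x e + ∑ e ∈ bisetCut ends Y, x e -
        (∑ e ∈ bisetCut ends A, x e + ∑ e ∈ bisetCut ends B, x e) := by
    simp only [sum_bisetCut, ← Finset.sum_add_distrib, ← Finset.sum_sub_distrib]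
    refine Finset.sum_congr rfl fun e _ => ?_
    push_cast
    ring
  have hnn := Finset.sum_nonneg hterm
  have hnn' : (0 : ℝ) ≤ ((∑ e ∈ bisetCut ends X, x e + ∑ e ∈ bisetCut ends Y, x e -
      (∑ e ∈ bisetCut ends A, x e + ∑ e ∈ bisetCut ends B, x e) : ℚ) : ℝ) := by
    rw [← hsum]; exact_mod_cast hnn
  have hX1 := hX.1
  have hY1 := hY.1
  rw [Rat.cast_sub, Rat.cast_add, Rat.cast_add] at hnn'
  refine ⟨by linarith, by linarith, fun e he => ?_⟩
  have hz : ((∑ e ∈ bisetCut ends X, x e + ∑ e ∈ bisetCut ends Y, x e -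
      (∑ e ∈ bisetCut ends A, x e + ∑ e ∈ bisetCut ends B, x e) : ℚ) : ℝ) = 0 := by
    rw [Rat.cast_sub, Rat.cast_add, Rat.cast_add]
    linarith
  have hz' := (hsum.trans (by exact_mod_cast hz))
  have h0 := (Finset.sum_eq_zero_iff_of_nonneg hterm).1 hz' e (Finset.mem_univ e)
  have h1 : (cutIndicator ends X e + cutIndicator ends Y e -
      (cutIndicator ends A e + cutIndicator ends B e) : ℤ) = 0 := by
    exact_mod_cast (mul_eq_zero.1 h0).resolve_right he
  linarith

/-- Such a cut carries no `x`. This disposes of bisets produced by uncrossing whose demand is not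
positive and which therefore need not separate a terminal. -/
theorem sum_bisetCut_eq_zero {V : Type*} {ends : E → Sym2 V} {h : BisetFunction V}
    {X : Biset V} (hx : x ∈ coverPolyhedron ends h u) {z : E → ℚ}
    (hz : ∀ e, x e = 0 → z e = 0)
    (hX : h.value X = ((∑ e ∈ bisetCut ends X, x e : ℚ) : ℝ)) (hle : h.value X ≤ 0) :
    ∑ e ∈ bisetCut ends X, z e = 0 := by
  have h0 : ∑ e ∈ bisetCut ends X, x e = 0 := by
    refine le_antisymm ?_ (Finset.sum_nonneg fun e _ => hx.1 e)
    rw [hX] at hle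
    exact_mod_cast hle
  have h1 := (Finset.sum_eq_zero_iff_of_nonneg fun e _ => hx.1 e).1 h0
  exact Finset.sum_eq_zero fun e he => hz e (h1 e he)

/-- The uncrossing alternative is determined by the terminals of the two bisets. -/
theorem SkewSupermodular.uncross (hskew : h.SkewSupermodular)
    (hpos : ∀ X : NonemptyBiset V, 0 < h X → X ∈ terminalBisets T)
    (hX : 0 < h.value X) (hY : 0 < h.value Y) {s t : V} (ht : X.SeparatesAt T t)
    (hs : Y.SeparatesAt T s) :
    (t = s → h.value X + h.value Y ≤ h.value (X.inter Y) + h.value (X.union Y)) ∧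
    (t ≠ s → h.value X + h.value Y ≤ h.value (X.diff Y) + h.value (Y.diff X)) := by
  obtain ⟨X, rfl⟩ := exists_of_value_pos hX
  obtain ⟨Y, rfl⟩ := exists_of_value_pos hY
  have hor := hskew X Y (by rwa [← value_coe h]) (by rwa [← value_coe h])
  rw [← value_coe h, ← value_coe h] at hor
  have hle : ∀ {A : Biset V}, (∀ r, ¬ A.SeparatesAt T r) → h.value A ≤ 0 := by
    intro A hA
    by_contra! hlt
    obtain ⟨r, hr⟩ := exists_separatesAt hpos hlt
    exact hA r hr
  constructor
  · rintro rfl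
    refine hor.resolve_right fun hd => ?_
    -- The only terminal of `X` is removed with `Y`, so the difference has no terminal left.
    have h1 : h.value (X.1.diff Y.1) ≤ 0 := hle fun r hr => by
      have hrm := hr.mem.1
      simp only [Biset.diff, Finset.mem_sdiff] at hrm
      obtain rfl := ht.eq_of_mem (X.1.inner_subset_outer hrm.1) hr.mem.2.2
      exact hrm.2 hs.mem.2.1
    have h2 : h.value (Y.1.diff X.1) ≤ 0 := hle fun r hr => by
      have hrm := hr.mem.1
      simp only [Biset.diff, Finset.mem_sdiff] at hrm
      obtain rfl := hs.eq_of_mem (Y.1.inner_subset_outer hrm.1) hr.mem.2.2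
      exact hrm.2 ht.mem.2.1
    linarith
  · intro hts
    refine hor.resolve_left fun hd => ?_
    have h1 : h.value (X.1.inter Y.1) ≤ 0 := hle fun r hr => hts <|
      (ht.eq_of_mem (Biset.inter_le_left.2 hr.mem.2.1) hr.mem.2.2).symm.trans
        (hs.eq_of_mem (Biset.inter_le_right.2 hr.mem.2.1) hr.mem.2.2)
    have h2 : h.value (X.1.union Y.1) ≤ 0 := hle fun r hr => hts <|
      (hr.eq_of_mem (Biset.le_union_left.2 ht.mem.2.1) ht.mem.2.2).trans
        (hr.eq_of_mem (Biset.le_union_right.2 hs.mem.2.1) hs.mem.2.2).symm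
    linarith

/-- A vector vanishing on the cuts of a maximal non-crossing family of tight bisets, and off the
support of `x`, vanishes on all tight cuts. -/
theorem sum_bisetCut_eq_zero_of_maximal (hskew : h.SkewSupermodular)
    (hpos : ∀ X : NonemptyBiset V, 0 < h X → X ∈ terminalBisets T)
    (hx : x ∈ coverPolyhedron ends h u) {L : Finset (Biset V)}
    (hL : ∀ X ∈ L, IsTight ends h x X) (hNC : ∀ X ∈ L, ∀ Y ∈ L, X.NonCrossing Y)
    (hmax : ∀ X, IsTight ends h x X → (∀ Y ∈ L, Y.NonCrossing X) → X ∈ L)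
    {z : E → ℚ} (hz : ∀ e, x e = 0 → z e = 0)
    (hzL : ∀ X ∈ L, ∑ e ∈ bisetCut ends X, z e = 0) (hX : IsTight ends h x X) :
    ∑ e ∈ bisetCut ends X, z e = 0 := by
  classical
  -- Uncrossing `X` with some `Y ∈ L` yields bisets crossing strictly fewer members of `L`: `Y`
  -- drops out and no new member is crossed.
  induction hn : (L.filter fun Y => ¬ Y.NonCrossing X).card using Nat.strong_induction_on
    generalizing X with
  | _ n ih =>
  by_cases hcross : ∃ Y ∈ L, ¬ Y.NonCrossing X
  swap
  · push Not at hcross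
    exact hzL X (hmax X hX hcross)
  obtain ⟨Y, hYL, hYX⟩ := hcross
  have hY := hL Y hYL
  obtain ⟨t, ht⟩ := exists_separatesAt hpos hX.2
  obtain ⟨s, hs⟩ := exists_separatesAt hpos hY.2
  have step : ∀ A : Biset V, h.value A = ((∑ e ∈ bisetCut ends A, x e : ℚ) : ℝ) →
      Y.NonCrossing A → (∀ Z ∈ L, Z.NonCrossing X → Z.NonCrossing A) →
      ∑ e ∈ bisetCut ends A, z e = 0 := by
    intro A hA hYA hZA
    by_cases hA0 : 0 < h.value A
    · refine ih _ ?_ ⟨hA, hA0⟩ rfl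
      rw [← hn]
      refine Finset.card_lt_card (Finset.ssubset_iff_of_subset ?_ |>.2 ⟨Y, ?_, ?_⟩)
      · intro Z hZ
        rw [Finset.mem_filter] at hZ ⊢
        exact ⟨hZ.1, fun hZX => hZ.2 (hZA Z hZ.1 hZX)⟩
      · exact Finset.mem_filter.2 ⟨hYL, hYX⟩
      · exact fun hmem => (Finset.mem_filter.1 hmem).2 hYA
    · exact sum_bisetCut_eq_zero hx hz hA (not_lt.1 hA0)
  have combine : ∀ A B : Biset V, h.value X + h.value Y ≤ h.value A + h.value B →
      (∀ e, cutIndicator ends A e + cutIndicator ends B e ≤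
        cutIndicator ends X e + cutIndicator ends Y e) →
      Y.NonCrossing A → (∀ Z ∈ L, Z.NonCrossing X → Z.NonCrossing A) →
      Y.NonCrossing B → (∀ Z ∈ L, Z.NonCrossing X → Z.NonCrossing B) →
      ∑ e ∈ bisetCut ends X, z e = 0 := by
    intro A B hval hcut hYA hZA hYB hZB
    obtain ⟨hA, hB, heq⟩ := hX.uncross hx hY hval hcut
    have h1 := step A hA hYA hZA
    have h2 := step B hB hYB hZB
    have h3 := hzL Y hYL
    have h4 : ∑ e ∈ bisetCut ends X, z e + ∑ e ∈ bisetCut ends Y, z e =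
        ∑ e ∈ bisetCut ends A, z e + ∑ e ∈ bisetCut ends B, z e := by
      simp only [sum_bisetCut, ← Finset.sum_add_distrib, ← add_mul]
      refine Finset.sum_congr rfl fun e _ => ?_
      by_cases he : x e = 0
      · rw [hz e he, mul_zero, mul_zero]
      · congr 1
        exact_mod_cast (heq e he).symm
    linarith
  have hXY : ¬ X.NonCrossing Y := fun hc => hYX hc.symm
  obtain ⟨hsame, hdiff⟩ := hskew.uncross hpos hX.2 hY.2 ht hs
  by_cases hts : t = s
  · subst hts
    have hZ : ∀ Z ∈ L, Z.NonCrossing X →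
        Z.NonCrossing (X.inter Y) ∧ Z.NonCrossing (X.union Y) := by
      intro Z hZL hZX
      obtain ⟨r, hr⟩ := exists_separatesAt hpos (hL Z hZL).2
      exact Biset.NonCrossing.inter_and_union ht hs hr hXY hZX (hNC Z hZL Y hYL)
    exact combine _ _ (hsame rfl) (cutIndicator_inter_add_union_le X Y)
      (Or.inr (Or.inl Biset.inter_le_right)) (fun Z hZL hZX => (hZ Z hZL hZX).1)
      (Or.inl Biset.le_union_right) (fun Z hZL hZX => (hZ Z hZL hZX).2)
  · refine combine _ _ (hdiff hts) (cutIndicator_diff_add_diff_le X Y)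
      (Or.inr (Or.inr Biset.stronglyDisjoint_diff_right)) (fun Z hZL hZX => ?_)
      (Or.inr (Or.inl Biset.diff_le_left)) (fun Z hZL hZX => ?_)
    · obtain ⟨r, hr⟩ := exists_separatesAt hpos (hL Z hZL).2
      exact Biset.NonCrossing.diff ht hs hr hts hZX (hNC Z hZL Y hYL)
    · obtain ⟨r, hr⟩ := exists_separatesAt hpos (hL Z hZL).2
      exact Biset.NonCrossing.diff hs ht hr (Ne.symm hts) (hNC Z hZL Y hYL) hZX

end BisetFunction

/-! ### Extreme points and half-integrality. -/

namespace BisetFunction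

variable {V E : Type*} [DecidableEq V] [Fintype E] {ends : E → Sym2 V} {T : Finset V}
  {h : BisetFunction V} {u : E → ℕ} {x : E → ℚ}

/-- A vector vanishing on the integral coordinates of an extreme point and on all its tight cuts
is zero. -/
theorem eq_zero_of_mem_extremePoints {V : Type*} [Finite V] {ends : E → Sym2 V}
    {h : BisetFunction V}
    (hx : x ∈ Set.extremePoints ℚ (coverPolyhedron ends h u)) {z : E → ℚ}
    (hz : ∀ e, (∃ k : ℤ, x e = k) → z e = 0)
    (hzX : ∀ X, IsTight ends h x X → ∑ e ∈ bisetCut ends X, z e = 0) : z = 0 := by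
  -- Slack constraints survive small perturbations and `z` does not move the tight ones, so `x ± ε
  -- z` are both feasible.
  have hmem : ∀ᶠ ε : ℚ in nhds 0, x + ε • z ∈ coverPolyhedron ends h u := by
    have hcont : ∀ e, Continuous fun ε : ℚ => (x + ε • z) e := fun e => by
      simp only [Pi.add_apply, Pi.smul_apply, smul_eq_mul]
      fun_prop
    simp only [coverPolyhedron, Set.mem_ofPred_eq]
    refine Filter.Eventually.and (Filter.eventually_all.2 fun e => ?_)
      (Filter.Eventually.and (Filter.eventually_all.2 fun X => ?_)
        (Filter.eventually_all.2 fun e => ?_))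
    · by_cases hint : ∃ k : ℤ, x e = k
      · exact Filter.Eventually.of_forall fun ε => by simpa [hz e hint] using hx.1.1 e
      · have hlt : 0 < x e := lt_of_le_of_ne (hx.1.1 e) fun h0 => hint ⟨0, by simp [← h0]⟩
        exact ((hcont e).continuousAt.eventually_const_lt (by simpa using hlt)).mono
          fun _ => le_of_lt
    · by_cases hlt : h X < ((∑ e ∈ bisetCut ends X.1, x e : ℚ) : ℝ)
      · have hc : Continuous fun ε : ℚ => ((∑ e ∈ bisetCut ends X.1, (x + ε • z) e : ℚ) : ℝ) :=
          Rat.continuous_coe_real.comp (continuous_finsetSum _ fun e _ => hcont e)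
        exact (hc.continuousAt.eventually_const_lt (by simpa using hlt)).mono fun _ => le_of_lt
      · have heq : h.value X.1 = ((∑ e ∈ bisetCut ends X.1, x e : ℚ) : ℝ) := by
          rw [value_coe h]
          exact le_antisymm (hx.1.2.1 X) (not_lt.1 hlt)
        have h0 : ∑ e ∈ bisetCut ends X.1, z e = 0 := by
          by_cases hp : 0 < h.value X.1
          · exact hzX _ ⟨heq, hp⟩
          · exact sum_bisetCut_eq_zero hx.1 (fun e he => hz e ⟨0, by simp [he]⟩) heq
              (not_lt.1 hp)
        refine Filter.Eventually.of_forall fun ε => ?_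
        have h1 : ∑ e ∈ bisetCut ends X.1, (x + ε • z) e = ∑ e ∈ bisetCut ends X.1, x e := by
          simp only [Pi.add_apply, Pi.smul_apply, smul_eq_mul, Finset.sum_add_distrib,
            ← Finset.mul_sum, h0, mul_zero, add_zero]
        rw [h1]
        exact hx.1.2.1 X
    · by_cases hint : ∃ k : ℤ, x e = k
      · exact Filter.Eventually.of_forall fun ε => by simpa [hz e hint] using hx.1.2.2 e
      · have hlt : x e < u e := lt_of_le_of_ne (hx.1.2.2 e) fun h0 => hint ⟨u e, by simp [h0]⟩
        exact ((hcont e).continuousAt.eventually_lt_const (by simpa using hlt)).mono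
          fun _ => le_of_lt
  have hneg : ∀ᶠ ε : ℚ in nhds 0, x + (-ε) • z ∈ coverPolyhedron ends h u :=
    (continuous_neg.tendsto' (0 : ℚ) 0 neg_zero).eventually hmem
  obtain ⟨ε, ⟨h1, h2⟩, hε⟩ := (((hmem.and hneg).filter_mono nhdsWithin_le_nhds).and
    (self_mem_nhdsWithin : Set.Ioi (0 : ℚ) ∈ nhdsWithin 0 (Set.Ioi 0))).exists
  have h3 := hx.2 h1 h2 ⟨1 / 2, 1 / 2, by norm_num, by norm_num, by norm_num, by
    ext e
    simp only [Pi.add_apply, Pi.smul_apply, smul_eq_mul]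
    ring⟩
  have h4 : ε • z = 0 := by simpa using h3
  exact (smul_eq_zero.1 h4).resolve_left (ne_of_gt hε)

/-- There is a maximal pairwise non-crossing family of tight bisets. -/
theorem exists_maximal_nonCrossing {V : Type*} [Finite V] (ends : E → Sym2 V) (h : BisetFunction V)
    (x : E → ℚ) :
    ∃ L : Finset (Biset V), (∀ X ∈ L, IsTight ends h x X) ∧
      (∀ X ∈ L, ∀ Y ∈ L, X.NonCrossing Y) ∧
      ∀ X, IsTight ends h x X → (∀ Y ∈ L, Y.NonCrossing X) → X ∈ L := by
  classical
  obtain ⟨L, hL⟩ := (Set.toFinite {L : Finset (Biset V) | (∀ X ∈ L, IsTight ends h x X) ∧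
    ∀ X ∈ L, ∀ Y ∈ L, X.NonCrossing Y}).exists_maximal ⟨∅, by simp⟩
  refine ⟨L, hL.1.1, hL.1.2, fun X hX hXL => ?_⟩
  refine hL.2 (y := insert X L) ⟨?_, ?_⟩ (Finset.subset_insert X L) (Finset.mem_insert_self X L)
  · intro Y hY
    rcases Finset.mem_insert.1 hY with rfl | hY
    · exact hX
    · exact hL.1.1 Y hY
  · intro Y hY Z hZ
    rcases Finset.mem_insert.1 hY with hYX | hYL <;>
      rcases Finset.mem_insert.1 hZ with hZX | hZL
    · exact Or.inl (hYX.trans hZX.symm).le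
    · exact hYX ▸ (hXL Z hZL).symm
    · exact hZX ▸ hXL Y hYL
    · exact hL.1.2 Y hYL Z hZL

/-- Extreme points of the covering polyhedron of an integral function are half-integral. -/
theorem half_integral_of_mem_extremePoints [Finite V] (hskew : h.SkewSupermodular)
    (hpos : ∀ X : NonemptyBiset V, 0 < h X → X ∈ terminalBisets T) (hint : h.IntegerValued)
    (hx : x ∈ Set.extremePoints ℚ (coverPolyhedron ends h u)) (e : E) :
    ∃ k : ℤ, x e = (k : ℚ) / 2 := by
  obtain ⟨L, hL, hNC, hmax⟩ := exists_maximal_nonCrossing ends h x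
  obtain ⟨p, hp⟩ := exists_isPredecessor (fun X hX => exists_separatesAt hpos (hL X hX).2) hNC
  have hrow : ∀ (X : Biset V) (z : E → ℚ),
      ∑ e, ((cutIndicator ends X e - cutIndicator ends (p X) e : ℤ) : ℚ) * z e =
        ∑ e ∈ bisetCut ends X, z e - ∑ e ∈ bisetCut ends (p X), z e := by
    intro X z
    simp only [sum_bisetCut, ← Finset.sum_sub_distrib, Int.cast_sub, sub_mul]
  have hempty : ∀ z : E → ℚ, ∑ e ∈ bisetCut ends (Biset.empty V), z e = 0 := by
    intro z
    simp [sum_bisetCut, cutIndicator_empty]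
  have hLint : ∀ X ∈ L, ∃ k : ℤ, ∑ e ∈ bisetCut ends X, x e = k := by
    intro X hX
    obtain ⟨h1, h2⟩ := hL X hX
    obtain ⟨Y, rfl⟩ := exists_of_value_pos h2
    obtain ⟨k, hk⟩ := hint Y
    rw [value_coe h, hk] at h1
    exact ⟨k, by exact_mod_cast h1.symm⟩
  refine half_integral_of_two_nonzero_per_column
    (fun (X : L) e => cutIndicator ends X.1 e - cutIndicator ends (p X.1) e) x ?_
    (card_cutIndicator_sub_ne_zero_le_two hp hNC) ?_ ?_ e
  · intro X e
    have h1 := cutIndicator_nonneg (ends := ends) X.1 e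
    have h2 := cutIndicator_nonneg (ends := ends) (p X.1) e
    have h3 := cutIndicator_le_one (ends := ends) X.1 e
    have h4 := cutIndicator_le_one (ends := ends) (p X.1) e
    rw [abs_le]
    constructor <;> linarith
  · intro X
    obtain ⟨k, hk⟩ := hLint X X.2
    rcases (hp X X.2).1 with h1 | h1
    · obtain ⟨l, hl⟩ := hLint _ h1.1
      exact ⟨k - l, by rw [hrow, hk, hl]; push_cast; rfl⟩
    · exact ⟨k, by rw [hrow, hk, h1, hempty, sub_zero]⟩
  · intro z hz hzrow
    -- Telescoping up each chain recovers the cuts from the difference rows.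
    have hzL : ∀ X ∈ L, ∑ e ∈ bisetCut ends X, z e = 0 := by
      intro X
      induction X using WellFoundedLT.induction with
      | _ X ih =>
      intro hX
      have h1 := hzrow ⟨X, hX⟩
      simp only [hrow] at h1
      rcases (hp X hX).1 with h2 | h2
      · rw [ih _ h2.2 h2.1, sub_zero] at h1
        exact h1
      · rw [h2, hempty, sub_zero] at h1
        exact h1
    exact eq_zero_of_mem_extremePoints hx hz fun X hX =>
      sum_bisetCut_eq_zero_of_maximal hskew hpos hx.1 hL hNC hmax
        (fun e he => hz e ⟨0, by simp [he]⟩) hzL hX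

end BisetFunction

/-! ### Fractional parts. -/

/-- The fractional part of an extreme point is an extreme point of the residual polyhedron. -/
theorem sub_floor_mem_extremePoints {V E : Type*} [Fintype E] {ends : E → Sym2 V}
    {h : BisetFunction V} {u : E → ℕ} {x : E → ℚ}
    (hx : x ∈ Set.extremePoints ℚ (coverPolyhedron ends h u)) :
    (fun e => x e - (⌊x e⌋ : ℚ)) ∈ Set.extremePoints ℚ
      (coverPolyhedron ends (residualFunction ends h fun e => (⌊x e⌋ : ℚ)) fun _ => 1) := by
  refine ⟨⟨fun e => Int.fract_nonneg (x e), fun X => ?_, fun e => ?_⟩, fun a ha b hb hab => ?_⟩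
  · have := hx.1.2.1 X
    simp only [residualFunction, Finset.sum_sub_distrib, Rat.cast_sub]
    linarith
  · simpa using (Int.fract_lt_one (x e)).le
  · obtain ⟨c, d, hc, hd, hcd, hcomb⟩ := hab
    have hcombe : ∀ e, c * a e + d * b e = x e - ⌊x e⌋ := fun e => congrFun hcomb e
    -- Vanishing at the integral coordinates of `x` is needed where `x e = u e`. Elsewhere `⌊x e⌋ <
    -- u e`, and integrality of `u` leaves room for `w e ≤ 1`.
    have hlift : ∀ w ∈ coverPolyhedron ends (residualFunction ends h fun e => (⌊x e⌋ : ℚ))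
        (fun _ => 1), (∀ e, x e - ⌊x e⌋ = 0 → w e = 0) →
        (fun e => w e + ⌊x e⌋) ∈ coverPolyhedron ends h u := by
      intro w hw hw0
      refine ⟨fun e => ?_, fun X => ?_, fun e => ?_⟩
      · have : (0 : ℚ) ≤ ⌊x e⌋ := by exact_mod_cast Int.floor_nonneg.2 (hx.1.1 e)
        exact add_nonneg (hw.1 e) this
      · have := hw.2.1 X
        simp only [residualFunction] at this
        simp only [Finset.sum_add_distrib, Rat.cast_add]
        linarith
      · by_cases h0 : x e - ⌊x e⌋ = 0
        · have := hx.1.2.2 e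
          simp only [hw0 e h0]
          linarith
        · have h1 : (⌊x e⌋ : ℚ) < x e :=
            lt_of_le_of_ne (Int.floor_le _) fun heq => h0 (by linarith)
          have h2 : ⌊x e⌋ < (u e : ℤ) := by
            have := h1.trans_le (hx.1.2.2 e)
            exact_mod_cast this
          have h3 : (⌊x e⌋ : ℚ) + 1 ≤ u e := by exact_mod_cast h2
          have h4 := hw.2.2 e
          simp only [Nat.cast_one] at h4
          linarith
    have hzero : ∀ e, x e - ⌊x e⌋ = 0 → a e = 0 ∧ b e = 0 := by
      intro e he
      have h1 := hcombe e
      rw [he] at h1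
      have h2 := mul_nonneg hc.le (ha.1 e)
      have h3 := mul_nonneg hd.le (hb.1 e)
      exact ⟨(mul_eq_zero.1 (by linarith : c * a e = 0)).resolve_left hc.ne',
        (mul_eq_zero.1 (by linarith : d * b e = 0)).resolve_left hd.ne'⟩
    have hfin := hx.2 (hlift a ha fun e he => (hzero e he).1)
      (hlift b hb fun e he => (hzero e he).2) ⟨c, d, hc, hd, hcd, by
        ext e
        simp only [Pi.add_apply, Pi.smul_apply, smul_eq_mul]
        have h1 := hcombe e
        have h2 : c * (⌊x e⌋ : ℚ) + d * ⌊x e⌋ = ⌊x e⌋ := by rw [← add_mul, hcd, one_mul]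
        linarith⟩
    ext e
    have := congrFun hfin e
    linarith

theorem mainTheorem3 {V E : Type*} [Fintype V] [DecidableEq V] [Fintype E]
    (ends : E → Sym2 V) (T : Finset V) (h : BisetFunction V)
    (hskew : h.SkewSupermodular)
    (hpos : ∀ X : NonemptyBiset V, 0 < h X → X ∈ terminalBisets T)
    (u : E → ℕ) :
    (∀ x ∈ Set.extremePoints ℚ (coverPolyhedron ends h u),
      (fun e => x e - (⌊x e⌋ : ℚ)) ∈
        Set.extremePoints ℚ
          (coverPolyhedron ends (residualFunction ends h fun e => (⌊x e⌋ : ℚ)) fun _ => 1)) ∧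
    (h.IntegerValued →
      ∀ x ∈ Set.extremePoints ℚ (coverPolyhedron ends h u),
        ∀ e : E, ∃ k : ℤ, x e = (k : ℚ) / 2) :=
  ⟨fun _ hx => sub_floor_mem_extremePoints hx, fun hint _ hx e =>
    BisetFunction.half_integral_of_mem_extremePoints hskew hpos hint hx e⟩
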